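/- For an interval $I\subseteq\mathbb R$, $a\ge 1$ and $\sigma>0$ let $$G^{a,\sigma}(I)=\Big\{u\in C^\infty(I)\ :\ \exists\,C\ \ \forall n\ge 0,\ \ \sup_{x\in I}|u^{(n)}(x)|\le C\,\sigma^{-n}(n!)^a\Big\},\qquad \widehat G^{a,\sigma}(I)=G^{a,\sigma}(I)\setminus\bigcup_{\sigma'>\sigma}G^{a,\sigma'}(I),$$ with derivatives one-sided at endpoints belonging to $I$. (A.1) Let $z\in\mathbb C$ with $\operatorname{Im}z>0$ and $\sigma(z)=\tfrac12(|z|-|\operatorname{Re}z|)$. The function on $[0,\infty)$ given by $x\mapsto e^{iz/x}$ for $x>0$ and by $0$ at $x=0$ belongs to $\widehat G^{2,\sigma(z)}([0,\infty))$; that is, it lies in $G^{2,\sigma(z)}([0,\infty))$ but in no $G^{2,\sigma'}([0,\infty))$ with $\sigma'>\sigma(z)$. (A.2) Let $\sigma>0$, $u\in C_c^\infty(\mathbb R)$ (complex valued), $\widehat u(\xi)=\int_{\mathbb R}u(x)e^{-ix\xi}\,dx$ and $\langle\xi\rangle=(1+\xi^2)^{1/2}$. Then 1. if there is $C$ with $|\widehat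 u(\xi)|\le C\langle\xi\rangle^{-1/4}e^{-2|\sigma\xi|^{1/2}}$ for all $\xi\in\mathbb R$, then $u\in G^{2,\sigma}(\mathbb R)$; 2. if there is $C$ with $|\widehat u(\xi)|\le C e^{-2|\sigma\xi|^{1/2}}$ for all $\xi\in\mathbb R$, then there is $C'$ with $|u^{(n)}(x)|\le C'(n+1)^{1/2}\sigma^{-n}(n!)^2$ for all $n\ge 0$, $x\in\mathbb R$ (in particular $u\in G^{2,\sigma'}(\mathbb R)$ for every $0<\sigma'<\sigma$); 3. if $u\in G^{2,\sigma}(\mathbb R)$, then there is $C$ with $|\widehat u(\xi)|\le C\langle\xi\rangle^{1/2}e^{-2|\sigma\xi|^{1/2}}$ for all $\xi\in\mathbb R$. -/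

import Mathlib

open scoped ContDiff Nat

noncomputable section

/-- The Gevrey class `G^{a,σ}(I)`: smooth functions `u` on `I` for which there is `C` with
`sup_I |D_x^n u| ≤ C σ^{-n} (n!)^a` for all `n`. Derivatives are taken within `I` (one-sided at
end points), so membership depends on `u` restricted to `I` only; `D_x = -i ∂_x`, hence
`|D_x^n u| = |∂_x^n u|`. -/
def gevreyClass (a σ : ℝ) (I : Set ℝ) : Set (ℝ → ℂ) :=
  {u | ContDiffOn ℝ ∞ u I ∧
    ∃ C : ℝ, ∀ n : ℕ, ∀ x ∈ I,
      ‖iteratedDerivWithin n u I x‖ ≤ C * (σ ^ n)⁻¹ * ((n ! : ℕ) : ℝ) ^ a}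

/-- The exact class: `G^{a,σ}(I)` minus the union of `G^{a,σ'}(I)` over `σ' > σ`. -/
def exactGevreyClass (a σ : ℝ) (I : Set ℝ) : Set (ℝ → ℂ) :=
  gevreyClass a σ I \ ⋃ σ' ∈ Set.Ioi σ, gevreyClass a σ' I

/-- The function `x ↦ e^{iz/x}` for `x > 0`, with its limiting value `0` at `x = 0`
(and `0` for `x < 0`). -/
def expInv (z : ℂ) (x : ℝ) : ℂ :=
  if 0 < x then Complex.exp (Complex.I * z / (x : ℂ)) else 0

/-- The Fourier transform in the convention `û(ξ) = ∫ u(x) e^{-i x ξ} dx`. -/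
def fourierHat (u : ℝ → ℂ) (ξ : ℝ) : ℂ :=
  ∫ x : ℝ, u x * Complex.exp (-(Complex.I * (x : ℂ) * (ξ : ℂ)))

/-- The Japanese bracket `⟨ξ⟩ = (1 + ξ²)^{1/2}`. -/
def japaneseBracket (ξ : ℝ) : ℝ := Real.sqrt (1 + ξ ^ 2)

end

open MeasureTheory Filter Topology Set
open scoped FourierTransform

/-! ### Factorials and the Gamma function -/

/-! Part (A.2) is Fourier inversion against moments of `exp (-2|σξ|^(1/2))`. The substitution `s =
|ξ|^(1/2)` turns the `n`-th moment with weight `|ξ|^(-θ)` into a multiple of `(4σ)^(-n) Γ(2n + 2 -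
2θ)`. Since `(2n)! √(2n+1) ≤ 4^n (n!)²`, the exponent `θ = 1/4` gives exactly `σ^(-n) (n!)²`, while
`θ = 0` costs a further `√(n+1)`. Conversely, `|ξ|^n |û(ξ)|` is at most a constant times `σ^(-n)
(n!)²`; choosing `n` to be the floor of `s = √(σ|ξ|)` and using Stirling yields `s e^(-2s)`, whence
the factor `⟨ξ⟩^(1/2)`.

Membership in (A.1) is Cauchy's estimate on the largest disc about `x` where `|e^(iz/ζ)| ≤ e^(-Im
z/(2x))`, followed by `y^n e^(-y) ≤ n!` with `y = Im z/(2x)`.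

For exactness, let `L(P)` be the Laplace transform of `e^(iz/x)`. All derivatives vanish at `0`, so
`P^n L(P)` is the transform of the `n`-th derivative, and a Gevrey bound with constant `σ` forces
decay like `e^(-2√(σ|P|))`. The true decay is governed by `√(-izP)`, and its real part squared comes
arbitrarily close to `σ(z)|P|` as `P` approaches a suitable half of the imaginary axis. To avoid
asymptotics of the Bessel function `K₁`, `L(p + r²)` is integrated over real `r`. This inserts
`√(π/x)` and leaves an integral of `K_{1/2}` type, which is an exact exponential
(`besselIntegral_eq`). Comparing the two rates contradicts `σ > σ(z)`. -/

/-- The Stirling sequence decreases, so it is bounded by its value `e/√2` at `1`. -/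
lemma factorial_le_exp_mul_sqrt_mul_pow {n : ℕ} (hn : 1 ≤ n) :
    (n ! : ℝ) ≤ Real.exp 1 * √n * (n / Real.exp 1) ^ n := by
  obtain ⟨m, rfl⟩ : ∃ m, n = m.succ := ⟨n - 1, by omega⟩
  have h := Stirling.stirlingSeq'_antitone (Nat.zero_le m)
  simp only [Function.comp_apply, Stirling.stirlingSeq_one, Nat.succ_eq_add_one, zero_add] at h
  rw [Stirling.stirlingSeq, div_le_iff₀ (by positivity), Real.sqrt_mul (by norm_num)] at h
  refine h.trans (le_of_eq ?_)
  have : (√2 : ℝ) ≠ 0 := by positivity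
  simp only [Nat.succ_eq_add_one]
  field_simp

/-- Optimising `n!² s^{-2n}` over `n` gives `s e^{-2s}` up to a constant. -/
lemma exists_sq_factorial_div_pow_le {s : ℝ} (hs : 1 ≤ s) :
    ∃ n : ℕ, (n ! : ℝ) ^ 2 / (s ^ 2) ^ n ≤ Real.exp 4 * s * Real.exp (-2 * s) := by
  have hs0 : 0 < s := by linarith
  refine ⟨⌊s⌋₊, ?_⟩
  set n := ⌊s⌋₊ with hn
  have h1 : 1 ≤ n := Nat.le_floor (by simpa using hs)
  have hle : (n : ℝ) ≤ s := Nat.floor_le hs0.le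
  have hlt : s < n + 1 := Nat.lt_floor_add_one s
  -- Rounding `s` down loses less than one unit in the exponent, hence one factor `e`; with
  -- Stirling's `e` and the square this makes `e^4`.
  have hpow : ((n : ℝ) / Real.exp 1) ^ n ≤ s ^ n * (Real.exp 1 * Real.exp (-s)) := by
    rw [div_eq_mul_inv, mul_pow, ← Real.exp_neg, ← Real.exp_nat_mul, ← Real.exp_add]
    gcongr
    linarith
  have h2 : (n ! : ℝ) ≤ Real.exp 1 * √s * (s ^ n * (Real.exp 1 * Real.exp (-s))) := by
    refine (factorial_le_exp_mul_sqrt_mul_pow h1).trans ?_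
    gcongr
  rw [div_le_iff₀ (by positivity)]
  calc (n ! : ℝ) ^ 2 ≤ (Real.exp 1 * √s * (s ^ n * (Real.exp 1 * Real.exp (-s)))) ^ 2 := by
        gcongr
    _ = Real.exp 1 ^ 4 * (√s) ^ 2 * Real.exp (-s) ^ 2 * (s ^ 2) ^ n := by ring
    _ = Real.exp 4 * s * Real.exp (-2 * s) * (s ^ 2) ^ n := by
        rw [Real.sq_sqrt hs0.le, ← Real.exp_nat_mul, ← Real.exp_nat_mul]
        norm_num

/-- The ratio of consecutive left sides is `4(2n+1)(2n+3)/(n+1)²`, which is below `16`. The saving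
of `√(2n+1)` over `4^n` is what the weight `⟨ξ⟩^(-1/4)` needs. -/
lemma sq_centralBinom_mul_le (n : ℕ) : n.centralBinom ^ 2 * (2 * n + 1) ≤ 16 ^ n := by
  induction n with
  | zero => simp
  | succ n ih =>
    have h := Nat.succ_mul_centralBinom_succ n
    have hpos : 0 < (n + 1) ^ 2 := by positivity
    refine Nat.le_of_mul_le_mul_left ?_ hpos
    calc (n + 1) ^ 2 * ((n + 1).centralBinom ^ 2 * (2 * (n + 1) + 1))
        = ((n + 1) * (n + 1).centralBinom) ^ 2 * (2 * n + 3) := by ring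
      _ = (n.centralBinom ^ 2 * (2 * n + 1)) * (4 * ((2 * n + 1) * (2 * n + 3))) := by
          rw [h]; ring
      _ ≤ 16 ^ n * (16 * (n + 1) ^ 2) := by
          exact Nat.mul_le_mul ih (by nlinarith)
      _ = (n + 1) ^ 2 * 16 ^ (n + 1) := by ring

lemma factorial_two_mul_mul_sqrt_le (n : ℕ) :
    ((2 * n)! : ℝ) * √(2 * n + 1) ≤ 4 ^ n * (n ! : ℝ) ^ 2 := by
  have h : ((2 * n)! : ℝ) = n.centralBinom * (n ! : ℝ) ^ 2 := by
    have := Nat.choose_mul_factorial_mul_factorial (show n ≤ 2 * n by omega)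
    rw [show 2 * n - n = n by omega, ← Nat.centralBinom_eq_two_mul_choose] at this
    rw [← this]; push_cast; ring
  have h2 : (n.centralBinom : ℝ) * √(2 * n + 1) ≤ 4 ^ n := by
    refine abs_le_of_sq_le_sq' ?_ (by positivity) |>.2
    rw [mul_pow, Real.sq_sqrt (by positivity), ← pow_mul, mul_comm n 2, pow_mul]
    norm_num
    exact_mod_cast sq_centralBinom_mul_le n
  calc ((2 * n)! : ℝ) * √(2 * n + 1)
      = (n.centralBinom * √(2 * n + 1)) * (n ! : ℝ) ^ 2 := by rw [h]; ring
    _ ≤ _ := by gcongr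

lemma Gamma_two_mul_add_two_le (n : ℕ) :
    Real.Gamma (2 * n + 2) ≤ √(2 * n + 1) * (4 ^ n * (n ! : ℝ) ^ 2) := by
  have h : Real.Gamma (2 * n + 2) = (2 * n + 1) * ((2 * n)! : ℝ) := by
    have := Real.Gamma_nat_eq_factorial (2 * n + 1)
    push_cast [Nat.factorial_succ] at this
    rw [← this]; ring_nf
  have h2 : (2 * n + 1 : ℝ) = √(2 * n + 1) * √(2 * n + 1) := by
    rw [Real.mul_self_sqrt (by positivity)]
  rw [h]
  nth_rewrite 1 [h2]
  rw [mul_assoc, mul_comm (√(2 * n + 1 : ℝ)) ((2 * n)! : ℝ)]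
  exact mul_le_mul_of_nonneg_left (factorial_two_mul_mul_sqrt_le n) (Real.sqrt_nonneg _)

/-- Log-convexity of `Γ` at the midpoint of `2n+1` and `2n+2` gives `(2n)! √(2n+1)`, exactly what
the central binomial bound absorbs. -/
lemma Gamma_two_mul_add_three_halves_le (n : ℕ) :
    Real.Gamma (2 * n + 3 / 2) ≤ 4 ^ n * (n ! : ℝ) ^ 2 := by
  have h := Real.Gamma_mul_add_mul_le_rpow_Gamma_mul_rpow_Gamma
    (s := 2 * n + 1) (t := 2 * n + 2) (a := 1 / 2) (b := 1 / 2)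
    (by positivity) (by positivity) (by norm_num) (by norm_num) (by norm_num)
  have h1 : Real.Gamma (2 * n + 1) = ((2 * n)! : ℝ) := by
    have := Real.Gamma_nat_eq_factorial (2 * n)
    push_cast at this
    exact this
  have h2 : Real.Gamma (2 * n + 2) = (2 * n + 1) * ((2 * n)! : ℝ) := by
    rw [← h1, ← Real.Gamma_add_one (by positivity)]; ring_nf
  rw [h1, h2, ← Real.sqrt_eq_rpow, ← Real.sqrt_eq_rpow, Real.sqrt_mul (by positivity)] at h
  calc Real.Gamma (2 * n + 3 / 2)
      = Real.Gamma (1 / 2 * (2 * n + 1) + 1 / 2 * (2 * n + 2)) := by ring_nf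
    _ ≤ _ := h
    _ = (√((2 * n)! : ℝ) * √((2 * n)! : ℝ)) * √(2 * n + 1) := by ring
    _ = ((2 * n)! : ℝ) * √(2 * n + 1) := by rw [Real.mul_self_sqrt (by positivity)]
    _ ≤ _ := factorial_two_mul_mul_sqrt_le n

/-! ### The Fourier transform of smooth compactly supported functions -/

lemma fourierHat_eq_fourier (u : ℝ → ℂ) (ξ : ℝ) : fourierHat u ξ = 𝓕 u (ξ / (2 * Real.pi)) := by
  rw [Real.fourier_real_eq_integral_exp_smul, fourierHat]
  congr 1
  ext x
  rw [smul_eq_mul, mul_comm]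
  congr 2
  push_cast
  have : (Real.pi : ℂ) ≠ 0 := by exact_mod_cast Real.pi_ne_zero
  field_simp

lemma continuous_fourier_of_integrable {u : ℝ → ℂ} (hu : Integrable u) : Continuous (𝓕 u) :=
  VectorFourier.fourierIntegral_continuous Real.continuous_fourierChar
    (by exact continuous_inner) hu

lemma tsupport_iteratedDeriv_subset (u : ℝ → ℂ) (n : ℕ) :
    tsupport (iteratedDeriv n u) ⊆ tsupport u := by
  induction n with
  | zero => simp
  | succ n ih => rw [iteratedDeriv_succ]; exact tsupport_deriv_subset.trans ih

lemma HasCompactSupport.iteratedDeriv_right {u : ℝ → ℂ} (hc : HasCompactSupport u) (n : ℕ) :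
    HasCompactSupport (iteratedDeriv n u) := by
  induction n with
  | zero => simpa using hc
  | succ n ih => rw [iteratedDeriv_succ]; exact ih.deriv

lemma integrable_iteratedDeriv {u : ℝ → ℂ} (hu : ContDiff ℝ ∞ u) (hc : HasCompactSupport u)
    (n : ℕ) : Integrable (iteratedDeriv n u) :=
  (hu.continuous_iteratedDeriv n (by exact_mod_cast le_top)).integrable_of_hasCompactSupport
    (hc.iteratedDeriv_right n)

lemma norm_fourier_iteratedDeriv {u : ℝ → ℂ} (hu : ContDiff ℝ ∞ u) (hc : HasCompactSupport u)
    (n : ℕ) (y : ℝ) :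
    ‖𝓕 (iteratedDeriv n u) y‖ = |2 * Real.pi * y| ^ n * ‖fourierHat u (2 * Real.pi * y)‖ := by
  rw [Real.fourier_iteratedDeriv (N := ⊤) hu (fun n _ => integrable_iteratedDeriv hu hc n)
    le_top, fourierHat_eq_fourier, mul_div_cancel_left₀ _ (by positivity)]
  simp [abs_mul, mul_pow]

lemma abs_pow_mul_norm_fourierHat_le {u : ℝ → ℂ} (hu : ContDiff ℝ ∞ u)
    (hc : HasCompactSupport u) (n : ℕ) (ξ : ℝ) :
    |ξ| ^ n * ‖fourierHat u ξ‖ ≤ ∫ x, ‖iteratedDeriv n u x‖ := by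
  have h := norm_fourier_iteratedDeriv hu hc n (ξ / (2 * Real.pi))
  rw [mul_div_cancel₀ _ (by positivity)] at h
  rw [← h]
  exact VectorFourier.norm_fourierIntegral_le_integral_norm _ _ _ _ _

lemma norm_iteratedDeriv_le_integral_fourierHat {u : ℝ → ℂ} (hu : ContDiff ℝ ∞ u)
    (hc : HasCompactSupport u) (n : ℕ)
    (hi : Integrable fun ξ : ℝ => |ξ| ^ n * ‖fourierHat u ξ‖) (x : ℝ) :
    ‖iteratedDeriv n u x‖ ≤ (2 * Real.pi)⁻¹ * ∫ ξ : ℝ, |ξ| ^ n * ‖fourierHat u ξ‖ := by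
  have hcont := hu.continuous_iteratedDeriv n (by exact_mod_cast le_top)
  have hint := integrable_iteratedDeriv hu hc n
  have hpi : (2 * Real.pi) ≠ 0 := by positivity
  have hF : Integrable (𝓕 (iteratedDeriv n u)) := by
    rw [← integrable_norm_iff
      (continuous_fourier_of_integrable hint).aestronglyMeasurable]
    simp_rw [norm_fourier_iteratedDeriv hu hc]
    exact hi.comp_mul_left' hpi
  rw [← hint.fourierInv_fourier_eq hF hcont.continuousAt, Real.fourierInv_eq']
  refine (norm_integral_le_integral_norm _).trans (le_of_eq ?_)
  simp_rw [norm_smul, Complex.norm_exp_ofReal_mul_I, one_mul, norm_fourier_iteratedDeriv hu hc]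
  rw [Measure.integral_comp_mul_left (fun ξ : ℝ => |ξ| ^ n * ‖fourierHat u ξ‖) (2 * Real.pi),
    smul_eq_mul, abs_of_pos (by positivity)]

/-! ### Moments of the weight `exp (-2|σξ|^(1/2))` and the Gevrey–Fourier correspondence -/

lemma exp_neg_two_mul_abs_rpow {σ ξ : ℝ} (hσ : 0 < σ) :
    Real.exp (-2 * |σ * ξ| ^ (1 / 2 : ℝ)) = Real.exp (-(2 * √σ) * |ξ| ^ (1 / 2 : ℝ)) := by
  rw [abs_mul, abs_of_pos hσ, Real.mul_rpow hσ.le (abs_nonneg _), Real.sqrt_eq_rpow]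
  ring_nf

lemma integral_abs_rpow_mul_exp {σ q : ℝ} (hσ : 0 < σ) (hq : -1 < q) :
    ∫ ξ : ℝ, |ξ| ^ q * Real.exp (-(2 * √σ) * |ξ| ^ (1 / 2 : ℝ)) =
      4 * (4 * σ) ^ (-(q + 1)) * Real.Gamma (2 * q + 2) := by
  rw [integral_comp_abs (f := fun ξ : ℝ => ξ ^ q * Real.exp (-(2 * √σ) * ξ ^ (1 / 2 : ℝ))),
    integral_rpow_mul_exp_neg_mul_rpow (by norm_num) hq (by positivity)]
  have h : 4 * σ = (2 * √σ) ^ (2 : ℝ) := by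
    rw [Real.rpow_two, mul_pow, Real.sq_sqrt hσ.le]; norm_num
  rw [h, ← Real.rpow_mul (by positivity)]
  rw [show -(q + 1) / (1 / 2 : ℝ) = 2 * -(q + 1) by ring,
    show (q + 1) / (1 / 2 : ℝ) = 2 * q + 2 by ring]
  ring

lemma integrable_abs_rpow_mul_exp {σ q : ℝ} (hσ : 0 < σ) (hq : -1 < q) :
    Integrable fun ξ : ℝ => |ξ| ^ q * Real.exp (-(2 * √σ) * |ξ| ^ (1 / 2 : ℝ)) := by
  -- A non-integrable function has integral `0` by convention, whereas the value already computed is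
  -- positive.
  refine not_imp_comm.1 integral_undef ?_
  rw [integral_abs_rpow_mul_exp hσ hq]
  have := Real.Gamma_pos_of_pos (show 0 < 2 * q + 2 by linarith)
  positivity

/-- Common core of the two direct estimates, used with `θ = 1/4` and `θ = 0`. The condition `θ < 1`
keeps `|ξ|^(n-θ)` integrable at the origin even for `n = 0`. -/
lemma norm_iteratedDeriv_le_of_fourierHat_le {u : ℝ → ℂ} (hu : ContDiff ℝ ∞ u)
    (hc : HasCompactSupport u) {σ θ C : ℝ} (hσ : 0 < σ) (hθ : θ < 1)
    (h : ∀ ξ : ℝ, ξ ≠ 0 → ‖fourierHat u ξ‖ ≤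
      C * |ξ| ^ (-θ) * Real.exp (-2 * |σ * ξ| ^ (1 / 2 : ℝ))) (n : ℕ) (x : ℝ) :
    ‖iteratedDeriv n u x‖ ≤ (2 * Real.pi)⁻¹ * C * 4 * (4 * σ) ^ (θ - 1) *
      ((σ ^ n)⁻¹ * ((4 ^ n)⁻¹ * Real.Gamma (2 * n + (2 - 2 * θ)))) := by
  have hq : -1 < (n : ℝ) - θ := by
    have : (0 : ℝ) ≤ n := by positivity
    linarith
  have hI := (integrable_abs_rpow_mul_exp hσ hq).const_mul C
  have hle : ∀ᵐ ξ : ℝ, |ξ| ^ n * ‖fourierHat u ξ‖ ≤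
      C * (|ξ| ^ ((n : ℝ) - θ) * Real.exp (-(2 * √σ) * |ξ| ^ (1 / 2 : ℝ))) := by
    filter_upwards [Measure.ae_ne volume (0 : ℝ)] with ξ hξ
    have h1 := h ξ hξ
    rw [exp_neg_two_mul_abs_rpow hσ] at h1
    rw [sub_eq_add_neg, Real.rpow_add (abs_pos.2 hξ), Real.rpow_natCast]
    calc _ ≤ |ξ| ^ n * _ := mul_le_mul_of_nonneg_left h1 (by positivity)
      _ = _ := by ring
  have hcontF : Continuous (fourierHat u) := by
    have : fourierHat u = fun ξ => 𝓕 u (ξ / (2 * Real.pi)) := funext (fourierHat_eq_fourier u)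
    rw [this]
    have h0 := integrable_iteratedDeriv hu hc 0
    rw [iteratedDeriv_zero] at h0
    exact (continuous_fourier_of_integrable h0).comp (by fun_prop)
  have hi : Integrable fun ξ : ℝ => |ξ| ^ n * ‖fourierHat u ξ‖ := by
    refine hI.mono' (by fun_prop) ?_
    filter_upwards [hle] with ξ hξ
    rwa [Real.norm_of_nonneg (by positivity)]
  refine (norm_iteratedDeriv_le_integral_fourierHat hu hc n hi x).trans ?_
  have hmono := integral_mono_ae hi hI hle
  rw [integral_const_mul, integral_abs_rpow_mul_exp hσ hq] at hmono
  refine (mul_le_mul_of_nonneg_left hmono (by positivity)).trans (le_of_eq ?_)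
  rw [show -((n : ℝ) - θ + 1) = (θ - 1) - n by ring, Real.rpow_sub (by positivity),
    Real.rpow_natCast, mul_pow, show 2 * ((n : ℝ) - θ) + 2 = 2 * n + (2 - 2 * θ) by ring]
  field_simp

lemma japaneseBracket_pos (ξ : ℝ) : 0 < japaneseBracket ξ := by
  unfold japaneseBracket; positivity

lemma abs_le_japaneseBracket (ξ : ℝ) : |ξ| ≤ japaneseBracket ξ :=
  Real.abs_le_sqrt (by linarith)

theorem mem_gevreyClass_of_fourierHat_le {u : ℝ → ℂ} (hu : ContDiff ℝ ∞ u)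
    (hc : HasCompactSupport u) {σ C : ℝ} (hσ : 0 < σ)
    (h : ∀ ξ : ℝ, ‖fourierHat u ξ‖ ≤
      C * japaneseBracket ξ ^ (-(1 / 4) : ℝ) * Real.exp (-2 * |σ * ξ| ^ (1 / 2 : ℝ))) :
    u ∈ gevreyClass 2 σ univ := by
  have hC : 0 ≤ C := by
    have h0 := (norm_nonneg _).trans (h 0)
    have := Real.rpow_pos_of_pos (japaneseBracket_pos 0) (-(1 / 4))
    exact nonneg_of_mul_nonneg_left (nonneg_of_mul_nonneg_left h0 (Real.exp_pos _)) this
  refine ⟨hu.contDiffOn, (2 * Real.pi)⁻¹ * C * 4 * (4 * σ) ^ ((1 / 4 : ℝ) - 1), fun n x _ => ?_⟩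
  rw [iteratedDerivWithin_univ, Real.rpow_two, mul_assoc _ (σ ^ n)⁻¹]
  refine (norm_iteratedDeriv_le_of_fourierHat_le hu hc (C := C) (θ := 1 / 4) hσ (by norm_num)
    (fun ξ hξ => (h ξ).trans ?_) n x).trans ?_
  · gcongr ?_ * ?_ * ?_
    exact Real.rpow_le_rpow_of_nonpos (abs_pos.2 hξ) (abs_le_japaneseBracket ξ) (by norm_num)
  · gcongr
    rw [inv_mul_le_iff₀ (by positivity)]
    rw [show (2 : ℝ) - 2 * (1 / 4) = 3 / 2 by norm_num]
    exact Gamma_two_mul_add_three_halves_le n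

theorem norm_iteratedDeriv_le_sqrt_of_fourierHat_le {u : ℝ → ℂ} (hu : ContDiff ℝ ∞ u)
    (hc : HasCompactSupport u) {σ C : ℝ} (hσ : 0 < σ)
    (h : ∀ ξ : ℝ, ‖fourierHat u ξ‖ ≤ C * Real.exp (-2 * |σ * ξ| ^ (1 / 2 : ℝ))) :
    ∃ C : ℝ, ∀ (n : ℕ) (x : ℝ), ‖iteratedDeriv n u x‖ ≤
      C * ((n : ℝ) + 1) ^ (1 / 2 : ℝ) * (σ ^ n)⁻¹ * ((n ! : ℕ) : ℝ) ^ (2 : ℝ) := by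
  have hC : 0 ≤ C := nonneg_of_mul_nonneg_left ((norm_nonneg _).trans (h 0)) (Real.exp_pos _)
  refine ⟨(2 * Real.pi)⁻¹ * C * 4 * (4 * σ) ^ ((0 : ℝ) - 1) * √2, fun n x => ?_⟩
  refine (norm_iteratedDeriv_le_of_fourierHat_le hu hc (C := C) (θ := 0) hσ (by norm_num)
    (fun ξ hξ => (h ξ).trans ?_) n x).trans ?_
  · simp
  · have hG : (4 ^ n : ℝ)⁻¹ * Real.Gamma (2 * n + (2 - 2 * 0)) ≤
        √2 * ((n : ℝ) + 1) ^ (1 / 2 : ℝ) * (n ! : ℝ) ^ 2 := by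
      rw [inv_mul_le_iff₀ (by positivity), mul_zero, sub_zero, ← Real.sqrt_eq_rpow,
        ← Real.sqrt_mul (by norm_num)]
      refine (Gamma_two_mul_add_two_le n).trans ?_
      rw [mul_left_comm]
      gcongr
      linarith
    calc _ ≤ (2 * Real.pi)⁻¹ * C * 4 * (4 * σ) ^ ((0 : ℝ) - 1) *
        ((σ ^ n)⁻¹ * (√2 * ((n : ℝ) + 1) ^ (1 / 2 : ℝ) * (n ! : ℝ) ^ 2)) := by gcongr
      _ = _ := by rw [Real.rpow_two]; ring

theorem fourierHat_le_of_mem_gevreyClass {u : ℝ → ℂ} (hu : ContDiff ℝ ∞ u)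
    (hc : HasCompactSupport u) {σ : ℝ} (hσ : 0 < σ) (h : u ∈ gevreyClass 2 σ univ) :
    ∃ C : ℝ, ∀ ξ : ℝ, ‖fourierHat u ξ‖ ≤
      C * japaneseBracket ξ ^ (1 / 2 : ℝ) * Real.exp (-2 * |σ * ξ| ^ (1 / 2 : ℝ)) := by
  obtain ⟨-, C, hC⟩ := h
  simp only [iteratedDerivWithin_univ, mem_univ, true_imp_iff, Real.rpow_two] at hC
  have hC0 : 0 ≤ C := by simpa using (norm_nonneg _).trans (hC 0 0)
  set V : ℝ := volume.real (tsupport u) with hV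
  have hfin : volume (tsupport u) < ⊤ := hc.isCompact.measure_lt_top
  have hint : ∀ n : ℕ, ∫ x, ‖iteratedDeriv n u x‖ ≤ V * C * ((σ ^ n)⁻¹ * (n ! : ℝ) ^ 2) := by
    intro n
    have hsub : Function.support (fun x => ‖iteratedDeriv n u x‖) ⊆ tsupport u := by
      intro x hx
      exact tsupport_iteratedDeriv_subset u n (subset_tsupport _ (norm_ne_zero_iff.1 hx))
    rw [← setIntegral_eq_integral_of_forall_compl_eq_zero (s := tsupport u)
      (fun x hx => by
        by_contra hne
        exact hx (hsub hne))]
    refine (le_abs_self _).trans ?_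
    rw [← Real.norm_eq_abs]
    refine (norm_setIntegral_le_of_norm_le_const (C := C * (σ ^ n)⁻¹ * (n ! : ℝ) ^ 2) hfin
      (fun x _ => by simpa using hC n x)).trans (le_of_eq ?_)
    rw [hV]; ring
  have hJ : ∀ ξ, 1 ≤ japaneseBracket ξ := fun ξ =>
    Real.one_le_sqrt.2 (by nlinarith [sq_nonneg ξ])
  have hV0 : 0 ≤ V := measureReal_nonneg
  refine ⟨V * C * (Real.exp 4 * (1 + √σ)), fun ξ => ?_⟩
  rw [abs_mul, abs_of_pos hσ, ← Real.sqrt_eq_rpow, ← Real.sqrt_eq_rpow]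
  set s := √(σ * |ξ|) with hs
  have hs2 : s ^ 2 = σ * |ξ| := Real.sq_sqrt (by positivity)
  have hs0 : 0 ≤ s := Real.sqrt_nonneg _
  -- For `s ≤ 1` take `n = 0`; this covers `ξ = 0`. The second clause guarantees `|ξ|^n > 0` for the
  -- later division.
  have key : ∃ n : ℕ, (n ! : ℝ) ^ 2 / (s ^ 2) ^ n ≤ Real.exp 4 * (1 + s) * Real.exp (-2 * s) ∧
      (n = 0 ∨ 0 < s) := by
    rcases le_total s 1 with h1 | h1
    · refine ⟨0, ?_, Or.inl rfl⟩
      simp only [Nat.factorial_zero, Nat.cast_one, one_pow, pow_zero, div_one]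
      rw [mul_right_comm, ← Real.exp_add]
      nlinarith [Real.one_le_exp (show 0 ≤ 4 + -2 * s by linarith)]
    · obtain ⟨n, hn⟩ := exists_sq_factorial_div_pow_le h1
      refine ⟨n, hn.trans ?_, Or.inr (by linarith)⟩
      gcongr
      linarith
  obtain ⟨n, hn, hor⟩ := key
  have hpos : 0 < |ξ| ^ n := by
    rcases hor with rfl | h
    · simp
    · have : 0 < |ξ| := by
        by_contra hneg
        have : |ξ| = 0 := le_antisymm (not_lt.1 hneg) (abs_nonneg _)
        rw [this] at hs2; nlinarith
      positivity
  have h1 : ‖fourierHat u ξ‖ ≤ V * C * ((n ! : ℝ) ^ 2 / (s ^ 2) ^ n) := by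
    have := (abs_pow_mul_norm_fourierHat_le hu hc n ξ).trans (hint n)
    rw [← le_div_iff₀' hpos] at this
    refine this.trans (le_of_eq ?_)
    rw [hs2, mul_pow]
    field_simp
  refine h1.trans ((mul_le_mul_of_nonneg_left hn (by positivity)).trans ?_)
  have h2 : 1 + s ≤ (1 + √σ) * √(japaneseBracket ξ) := by
    have ha : 1 ≤ √(japaneseBracket ξ) := Real.one_le_sqrt.2 (hJ ξ)
    have hb : s ≤ √σ * √(japaneseBracket ξ) := by
      rw [hs, ← Real.sqrt_mul hσ.le]
      gcongr
      exact abs_le_japaneseBracket ξ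
    linarith
  calc V * C * (Real.exp 4 * (1 + s) * Real.exp (-2 * s))
      ≤ V * C * (Real.exp 4 * ((1 + √σ) * √(japaneseBracket ξ)) * Real.exp (-2 * s)) := by gcongr
    _ = _ := by ring

/-! ### Cauchy estimates for `e^{iz/x}` -/

lemma norm_sub_abs_re_pos {z : ℂ} (hz : 0 < z.im) : 0 < ‖z‖ - |z.re| :=
  sub_pos.2 (Complex.abs_re_lt_norm.2 hz.ne')

lemma norm_sub_abs_re_div_im_le_one {z : ℂ} (hz : 0 < z.im) : (‖z‖ - |z.re|) / z.im ≤ 1 := by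
  rw [div_le_one hz]
  have := Complex.norm_le_abs_re_add_abs_im z
  rw [abs_of_pos hz] at this
  linarith

/-- For `ζ ≠ 0` the conclusion describes the disc with centre `x(1 - i Re z/Im z)` and radius
`x|z|/Im z`, whose boundary passes through `0`. The largest disc about `x` inside it has radius
`ρx`, the difference of that radius and the distance between centres. -/
lemma re_I_mul_div_le {z ζ : ℂ} {x : ℝ} (hz : 0 < z.im) (hx : 0 < x) (hζ0 : ζ ≠ 0)
    (hζ : ‖ζ - x‖ ≤ (‖z‖ - |z.re|) / z.im * x) :
    (Complex.I * z / ζ).re ≤ -(z.im / (2 * x)) := by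
  set ρ := (‖z‖ - |z.re|) / z.im with hρ
  have hρ0 : 0 < ρ := div_pos (norm_sub_abs_re_pos hz) hz
  -- `ρ` is the positive root of this quadratic, which expresses internal tangency of the two discs.
  have hρ1 : z.im * ρ ^ 2 + 2 * |z.re| * ρ = z.im := by
    have hN : ‖z‖ ^ 2 = |z.re| ^ 2 + z.im ^ 2 := by
      rw [Complex.sq_norm, Complex.normSq_apply, sq_abs]; ring
    rw [hρ]
    field_simp
    nlinarith
  have hb : |ζ.im| ≤ ρ * x := by
    have := (Complex.abs_im_le_norm (ζ - x)).trans hζ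
    simpa using this
  have hsq : (ζ.re - x) ^ 2 + ζ.im ^ 2 ≤ (ρ * x) ^ 2 := by
    have h := pow_le_pow_left₀ (norm_nonneg _) hζ 2
    rw [Complex.sq_norm, Complex.normSq_apply] at h
    simp only [Complex.sub_re, Complex.ofReal_re, Complex.sub_im, Complex.ofReal_im,
      sub_zero] at h
    nlinarith
  have hn : 0 < Complex.normSq ζ := Complex.normSq_pos.2 hζ0
  have hre : (Complex.I * z / ζ).re = (-z.im * ζ.re + z.re * ζ.im) / Complex.normSq ζ := by
    rw [Complex.div_re]
    simp
    ring
  have hab : -(z.re * ζ.im) ≥ -(|z.re| * (ρ * x)) := by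
    have := (le_abs_self (z.re * ζ.im)).trans (le_of_eq (abs_mul _ _))
    have h2 := mul_le_mul_of_nonneg_left hb (abs_nonneg z.re)
    linarith
  rw [hre, neg_div', div_le_div_iff₀ hn (by positivity), Complex.normSq_apply]
  have h1 := mul_le_mul_of_nonneg_left hsq hz.le
  have h2 := mul_le_mul_of_nonneg_left hab hx.le
  have h3 : (z.im * ρ ^ 2 + 2 * |z.re| * ρ) * x ^ 2 = z.im * x ^ 2 := by rw [hρ1]
  nlinarith

lemma analyticAt_exp_I_mul_div (z : ℂ) {ζ : ℂ} (hζ : ζ ≠ 0) :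
    AnalyticAt ℂ (fun ζ : ℂ => Complex.exp (Complex.I * z / ζ)) ζ :=
  (analyticAt_const.div analyticAt_id hζ).cexp

lemma norm_iteratedDeriv_exp_I_mul_div_mul_pow_le {z : ℂ} {x : ℝ} (hz : 0 < z.im) (hx : 0 < x)
    (n : ℕ) :
    ‖iteratedDeriv n (fun ζ : ℂ => Complex.exp (Complex.I * z / ζ)) x‖ *
      ((‖z‖ - |z.re|) / z.im * x) ^ n ≤ n ! * Real.exp (-(z.im / (2 * x))) := by
  set ρ := (‖z‖ - |z.re|) / z.im with hρ
  have hρ0 : 0 < ρ := div_pos (norm_sub_abs_re_pos hz) hz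
  have hρ1 : ρ ≤ 1 := norm_sub_abs_re_div_im_le_one hz
  set D := ‖iteratedDeriv n (fun ζ : ℂ => Complex.exp (Complex.I * z / ζ)) x‖
  -- When `Re z = 0` one has `ρ = 1`, and the closed disc of radius `ρx` reaches the singularity at
  -- `0`. Cauchy's estimate is applied with `r < ρ`, then `r → ρ`.
  have hlim : Tendsto (fun r : ℝ => D * (r * x) ^ n) (𝓝[<] ρ) (𝓝 (D * (ρ * x) ^ n)) :=
    (Continuous.tendsto (by fun_prop) ρ).mono_left nhdsWithin_le_nhds
  refine le_of_tendsto hlim ?_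
  filter_upwards [Ioo_mem_nhdsLT hρ0] with r hr
  have hrx : 0 < r * x := mul_pos hr.1 hx
  have hne : ∀ ζ : ℂ, ‖ζ - x‖ ≤ r * x → ζ ≠ 0 := by
    rintro ζ hζ rfl
    rw [zero_sub, norm_neg, Complex.norm_real, Real.norm_of_nonneg hx.le] at hζ
    nlinarith [hr.2]
  have h := Complex.norm_iteratedDeriv_le_of_forall_mem_sphere_norm_le (c := (x : ℂ))
    (C := Real.exp (-(z.im / (2 * x))))
    (f := fun ζ : ℂ => Complex.exp (Complex.I * z / ζ)) n hrx ?_ ?_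
  · rwa [le_div_iff₀ (by positivity)] at h
  · refine DifferentiableOn.diffContOnCl fun ζ hζ => ?_
    rw [closure_ball _ hrx.ne', mem_closedBall_iff_norm] at hζ
    exact (analyticAt_exp_I_mul_div z (hne ζ hζ)).differentiableAt.differentiableWithinAt
  · intro ζ hζ
    rw [mem_sphere_iff_norm] at hζ
    rw [Complex.norm_exp]
    refine Real.exp_le_exp.2 (re_I_mul_div_le hz hx (hne ζ hζ.le) ?_)
    rw [hζ]
    exact mul_le_mul_of_nonneg_right hr.2.le hx.le

lemma pow_mul_exp_neg_le {y : ℝ} (hy : 0 ≤ y) (n : ℕ) : y ^ n * Real.exp (-y) ≤ n ! := by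
  have := Real.pow_div_factorial_le_exp y hy n
  rw [div_le_iff₀ (by positivity)] at this
  rw [Real.exp_neg, ← div_eq_mul_inv, div_le_iff₀ (Real.exp_pos _)]
  linarith

/-- The `n`-th derivative of `expInv z`. -/
noncomputable def expInvDeriv (z : ℂ) (n : ℕ) (x : ℝ) : ℂ :=
  if 0 < x then iteratedDeriv n (fun ζ : ℂ => Complex.exp (Complex.I * z / ζ)) x else 0

lemma norm_expInvDeriv_le {z : ℂ} (hz : 0 < z.im) (n : ℕ) (x : ℝ) :
    ‖expInvDeriv z n x‖ ≤ (((‖z‖ - |z.re|) / 2) ^ n)⁻¹ * (n ! : ℝ) ^ 2 := by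
  have hσ := norm_sub_abs_re_pos hz
  unfold expInvDeriv
  split_ifs with hx
  · have h := norm_iteratedDeriv_exp_I_mul_div_mul_pow_le hz hx n
    have h2 := pow_mul_exp_neg_le (y := z.im / (2 * x)) (by positivity) n
    rw [← div_eq_inv_mul, le_div_iff₀ (by positivity)]
    -- The Cauchy radius times the decay exponent is independent of `x`, and it is exactly `σ(z)`.
    have h3 : (‖z‖ - |z.re|) / 2 = (‖z‖ - |z.re|) / z.im * x * (z.im / (2 * x)) := by
      field_simp
    rw [h3, mul_pow, ← mul_assoc]
    calc _ ≤ n ! * Real.exp (-(z.im / (2 * x))) * (z.im / (2 * x)) ^ n := by gcongr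
      _ = n ! * ((z.im / (2 * x)) ^ n * Real.exp (-(z.im / (2 * x)))) := by ring
      _ ≤ n ! * n ! := by gcongr
      _ = _ := by ring
  · rw [norm_zero]; positivity

/-- Quadratic vanishing at `0` makes each `expInvDeriv z n` differentiable there with derivative
`0`. The power `n + 2` of the exponential decay pays for the `x^(-n)` of Cauchy's estimate and
leaves `x²`. -/
lemma exists_norm_expInvDeriv_le_sq {z : ℂ} (hz : 0 < z.im) (n : ℕ) :
    ∃ C, ∀ x : ℝ, ‖expInvDeriv z n x‖ ≤ C * x ^ 2 := by
  have hσ := norm_sub_abs_re_pos hz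
  set ρ := (‖z‖ - |z.re|) / z.im with hρ
  have hρ0 : 0 < ρ := div_pos (norm_sub_abs_re_pos hz) hz
  refine ⟨n ! * (n + 2)! * (2 / z.im) ^ (n + 2) / ρ ^ n, fun x => ?_⟩
  unfold expInvDeriv
  split_ifs with hx
  · have h := norm_iteratedDeriv_exp_I_mul_div_mul_pow_le hz hx n
    have h2 := pow_mul_exp_neg_le (y := z.im / (2 * x)) (by positivity) (n + 2)
    rw [← le_div_iff₀' (by positivity)] at h2
    rw [← hρ, ← le_div_iff₀ (by positivity)] at h
    refine h.trans ?_
    calc _ ≤ n ! * ((n + 2)! / (z.im / (2 * x)) ^ (n + 2)) / (ρ * x) ^ n := by gcongr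
      _ = _ := by
        rw [div_pow, div_pow, mul_pow, mul_pow, pow_add x]
        field_simp
  · rw [norm_zero]; positivity

lemma hasDerivAt_expInvDeriv {z : ℂ} (hz : 0 < z.im) (n : ℕ) (x : ℝ) :
    HasDerivAt (expInvDeriv z n) (expInvDeriv z (n + 1) x) x := by
  rcases lt_trichotomy x 0 with hx | rfl | hx
  · rw [expInvDeriv, if_neg hx.not_gt]
    refine (hasDerivAt_const x (0 : ℂ)).congr_of_eventuallyEq ?_
    filter_upwards [Iio_mem_nhds hx] with y hy
    rw [expInvDeriv, if_neg (not_lt.2 (le_of_lt hy))]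
  · rw [expInvDeriv, if_neg (lt_irrefl _)]
    obtain ⟨C, hC⟩ := exists_norm_expInvDeriv_le_sq hz n
    have : (expInvDeriv z n) =O[𝓝 0] fun x : ℝ => ‖x - 0‖ ^ 2 :=
      Asymptotics.IsBigO.of_bound C (Eventually.of_forall fun x => by simpa using hC x)
    simpa using (this.hasFDerivAt one_lt_two).hasDerivAt
  · rw [expInvDeriv, if_pos hx, iteratedDeriv_succ]
    have hx' : (x : ℂ) ≠ 0 := by exact_mod_cast hx.ne'
    have h := ((analyticAt_exp_I_mul_div z hx').iterated_deriv n).differentiableAt.hasDerivAt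
    rw [← iteratedDeriv_eq_iterate] at h
    refine h.comp_ofReal.congr_of_eventuallyEq ?_
    filter_upwards [Ioi_mem_nhds hx] with y hy
    exact if_pos (mem_Ioi.1 hy)

lemma iteratedDeriv_expInv {z : ℂ} (hz : 0 < z.im) (n : ℕ) :
    iteratedDeriv n (expInv z) = expInvDeriv z n := by
  induction n with
  | zero => ext x; simp [expInvDeriv, expInv]
  | succ n ih =>
    rw [iteratedDeriv_succ, ih]
    exact funext fun x => (hasDerivAt_expInvDeriv hz n x).deriv

lemma contDiff_expInv {z : ℂ} (hz : 0 < z.im) : ContDiff ℝ ∞ (expInv z) :=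
  contDiff_of_differentiable_iteratedDeriv (n := ⊤) fun m _ x => by
    rw [iteratedDeriv_expInv hz]
    exact (hasDerivAt_expInvDeriv hz m x).differentiableAt

/-- The extension by `0` is smooth on the whole line, so one-sided derivatives at the endpoint are
ordinary ones. -/
lemma iteratedDerivWithin_expInv {z : ℂ} (hz : 0 < z.im) (n : ℕ) {x : ℝ} (hx : x ∈ Ici (0 : ℝ)) :
    iteratedDerivWithin n (expInv z) (Ici 0) x = expInvDeriv z n x := by
  rw [iteratedDerivWithin_eq_iteratedDeriv (uniqueDiffOn_Ici 0)
    (((contDiff_expInv hz).of_le (by exact_mod_cast le_top)).contDiffAt) hx,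
    iteratedDeriv_expInv hz]

theorem expInv_mem_gevreyClass {z : ℂ} (hz : 0 < z.im) :
    expInv z ∈ gevreyClass 2 ((‖z‖ - |z.re|) / 2) (Ici 0) := by
  refine ⟨(contDiff_expInv hz).contDiffOn, 1, fun n x hx => ?_⟩
  rw [iteratedDerivWithin_expInv hz n hx, Real.rpow_two, one_mul]
  exact norm_expInvDeriv_le hz n x

/-! ### The integral `∫₀^∞ exp(-w t²/s² - p s²) ds` -/

/-- The integrand `exp(-w t²/s² - p s²)`. -/
noncomputable def besselKernel (w p : ℂ) (t s : ℝ) : ℂ :=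
  Complex.exp (-(w * (t / s) ^ 2) - p * s ^ 2)

lemma norm_besselKernel (w p : ℂ) (t s : ℝ) :
    ‖besselKernel w p t s‖ = Real.exp (-(w.re * (t / s) ^ 2)) * Real.exp (-p.re * s ^ 2) := by
  rw [besselKernel, Complex.norm_exp, ← Real.exp_add]
  congr 1
  have h1 : ((t / s : ℂ) ^ 2) = (((t / s) ^ 2 : ℝ) : ℂ) := by push_cast; ring
  have h2 : ((s : ℂ) ^ 2) = ((s ^ 2 : ℝ) : ℂ) := by push_cast; ring
  rw [h1, h2, Complex.sub_re, Complex.neg_re, Complex.re_mul_ofReal, Complex.re_mul_ofReal]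
  ring

lemma measurable_besselKernel (w p : ℂ) (t : ℝ) : Measurable (besselKernel w p t) := by
  unfold besselKernel; fun_prop

lemma norm_besselKernel_le {w : ℂ} (hw : 0 < w.re) (p : ℂ) (t s : ℝ) :
    ‖besselKernel w p t s‖ ≤ Real.exp (-p.re * s ^ 2) := by
  rw [norm_besselKernel]
  refine mul_le_of_le_one_left (Real.exp_pos _).le (Real.exp_le_one_iff.2 ?_)
  have := sq_nonneg (t / s)
  nlinarith

lemma pow_mul_norm_besselKernel_le {w : ℂ} (hw : 0 < w.re) (p : ℂ) (t s : ℝ) (n : ℕ) :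
    ((t / s) ^ 2) ^ n * ‖besselKernel w p t s‖ ≤ n ! / w.re ^ n * Real.exp (-p.re * s ^ 2) := by
  have h := pow_mul_exp_neg_le (y := w.re * (t / s) ^ 2) (by positivity) n
  rw [norm_besselKernel, ← mul_assoc]
  gcongr
  rw [le_div_iff₀ (by positivity)]
  rw [mul_pow] at h
  linarith

lemma hasDerivAt_besselKernel_param (w p : ℂ) (t s : ℝ) :
    HasDerivAt (fun t => besselKernel w p t s)
      (-2 * w * ((t / s ^ 2 : ℝ) * besselKernel w p t s)) t := by
  have h1 : HasDerivAt (fun t : ℝ => (t / s : ℂ)) (1 / s : ℂ) t :=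
    (Complex.ofRealCLM.hasDerivAt (x := t)).div_const (s : ℂ)
  have h := (((h1.pow 2).const_mul w).neg.sub_const (p * (s : ℂ) ^ 2)).cexp
  refine h.congr_deriv ?_
  simp only [besselKernel, Pi.neg_apply, Pi.pow_apply]
  push_cast
  ring

/-- The function `t ↦ ∫₀^∞ exp(-w t²/s² - p s²) ds`. -/
noncomputable def besselIntegral (w p : ℂ) (t : ℝ) : ℂ :=
  ∫ s in Ioi (0 : ℝ), besselKernel w p t s

/-- The function `t ↦ ∫₀^∞ (t/s²) exp(-w t²/s² - p s²) ds`. -/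
noncomputable def besselIntegralAux (w p : ℂ) (t : ℝ) : ℂ :=
  ∫ s in Ioi (0 : ℝ), (t / s ^ 2 : ℝ) * besselKernel w p t s

lemma integrableOn_exp_neg_mul_sq {p : ℂ} (hp : 0 < p.re) :
    IntegrableOn (fun s : ℝ => Real.exp (-p.re * s ^ 2)) (Ioi 0) :=
  (integrable_exp_neg_mul_sq hp).integrableOn

lemma integrableOn_besselKernel {w p : ℂ} (hw : 0 < w.re) (hp : 0 < p.re) (t : ℝ) :
    IntegrableOn (besselKernel w p t) (Ioi 0) :=
  (integrableOn_exp_neg_mul_sq hp).mono' (measurable_besselKernel w p t).aestronglyMeasurable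
    (Eventually.of_forall (norm_besselKernel_le hw p t))

lemma norm_aux_integrand_le {w : ℂ} (hw : 0 < w.re) (p : ℂ) {t : ℝ} (ht : 0 < t) (s : ℝ) :
    ‖((t / s ^ 2 : ℝ) : ℂ) * besselKernel w p t s‖ ≤
      1 / (w.re * t) * Real.exp (-p.re * s ^ 2) := by
  have h := pow_mul_norm_besselKernel_le hw p t s 1
  rw [norm_mul, Complex.norm_real, Real.norm_of_nonneg (by positivity)]
  have e : t / s ^ 2 = t⁻¹ * (t / s) ^ 2 := by rw [div_pow]; field_simp
  rw [pow_one, pow_one, Nat.factorial_one, Nat.cast_one] at h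
  rw [e, mul_assoc]
  refine (mul_le_mul_of_nonneg_left h (by positivity)).trans (le_of_eq ?_)
  field_simp

lemma integrableOn_aux_integrand {w p : ℂ} (hw : 0 < w.re) (hp : 0 < p.re) {t : ℝ}
    (ht : 0 < t) :
    IntegrableOn (fun s : ℝ => ((t / s ^ 2 : ℝ) : ℂ) * besselKernel w p t s) (Ioi 0) := by
  refine ((integrableOn_exp_neg_mul_sq hp).const_mul (1 / (w.re * t))).mono' ?_
    (Eventually.of_forall (norm_aux_integrand_le hw p ht))
  have := measurable_besselKernel w p t
  exact Measurable.aestronglyMeasurable (by fun_prop)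

lemma hasDerivAt_besselIntegral {w p : ℂ} (hw : 0 < w.re) (hp : 0 < p.re) {t : ℝ}
    (ht : 0 < t) :
    HasDerivAt (besselIntegral w p) (-2 * w * besselIntegralAux w p t) t := by
  have hI := (integrableOn_exp_neg_mul_sq hp).const_mul (‖-2 * w‖ * (1 / (w.re * (t / 2))))
  have h := hasDerivAt_integral_of_dominated_loc_of_deriv_le (μ := volume.restrict (Ioi 0))
    (F := besselKernel w p)
    (F' := fun t s => -2 * w * (((t / s ^ 2 : ℝ) : ℂ) * besselKernel w p t s))
    (Ioi_mem_nhds (half_lt_self ht))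
    (Eventually.of_forall fun t => (measurable_besselKernel w p t).aestronglyMeasurable)
    (integrableOn_besselKernel hw hp t)
    ((integrableOn_aux_integrand hw hp ht).const_mul _).aestronglyMeasurable
    (Eventually.of_forall fun s τ hτ => ?_) hI
    (Eventually.of_forall fun s τ _ => hasDerivAt_besselKernel_param w p τ s)
  · refine h.2.congr_deriv ?_
    rw [besselIntegralAux, ← integral_const_mul]
  · have hτ0 : t / 2 < τ := hτ
    have hτ1 : 0 < τ := by linarith
    rw [norm_mul, mul_assoc]
    gcongr
    refine (norm_aux_integrand_le hw p hτ1 s).trans ?_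
    gcongr

/-- The `t`-derivative of the integrand of `besselIntegralAux`. -/
noncomputable def besselAuxDeriv (w p : ℂ) (t s : ℝ) : ℂ :=
  ((1 / s ^ 2 : ℝ) - 2 * w * (t ^ 2 / s ^ 4 : ℝ)) * besselKernel w p t s

lemma norm_besselAuxDeriv_le {w : ℂ} (hw : 0 < w.re) (p : ℂ) {t : ℝ} (ht : 0 < t) {s : ℝ}
    (hs : 0 < s) :
    ‖besselAuxDeriv w p t s‖ ≤
      (1 / w.re + 4 * ‖w‖ / w.re ^ 2) / t ^ 2 * Real.exp (-p.re * s ^ 2) := by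
  have h1 := pow_mul_norm_besselKernel_le hw p t s 1
  have h2 := pow_mul_norm_besselKernel_le hw p t s 2
  rw [pow_one, pow_one, Nat.factorial_one, Nat.cast_one] at h1
  rw [Nat.factorial_two, Nat.cast_ofNat] at h2
  have hcoef : ‖((1 / s ^ 2 : ℝ) : ℂ) - 2 * w * (t ^ 2 / s ^ 4 : ℝ)‖ ≤
      (t ^ 2)⁻¹ * ((t / s) ^ 2) + 2 * ‖w‖ * ((t ^ 2)⁻¹ * ((t / s) ^ 2) ^ 2) := by
    refine (norm_sub_le _ _).trans (le_of_eq ?_)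
    rw [norm_mul, norm_mul, Complex.norm_real, Complex.norm_real, Real.norm_of_nonneg
      (by positivity), Real.norm_of_nonneg (by positivity), Complex.norm_ofNat]
    field_simp
  rw [besselAuxDeriv, norm_mul]
  calc _ ≤ ((t ^ 2)⁻¹ * ((t / s) ^ 2) + 2 * ‖w‖ * ((t ^ 2)⁻¹ * ((t / s) ^ 2) ^ 2)) *
        ‖besselKernel w p t s‖ := by gcongr
    _ = (t ^ 2)⁻¹ * ((t / s) ^ 2 * ‖besselKernel w p t s‖) + 2 * ‖w‖ * (t ^ 2)⁻¹ *
        (((t / s) ^ 2) ^ 2 * ‖besselKernel w p t s‖) := by ring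
    _ ≤ (t ^ 2)⁻¹ * (1 / w.re * Real.exp (-p.re * s ^ 2)) + 2 * ‖w‖ * (t ^ 2)⁻¹ *
        (2 / w.re ^ 2 * Real.exp (-p.re * s ^ 2)) := by gcongr
    _ = _ := by field_simp; ring

lemma measurable_besselAuxDeriv (w p : ℂ) (t : ℝ) : Measurable (besselAuxDeriv w p t) := by
  have := measurable_besselKernel w p t
  unfold besselAuxDeriv
  fun_prop

lemma integrableOn_besselAuxDeriv {w p : ℂ} (hw : 0 < w.re) (hp : 0 < p.re) {t : ℝ}
    (ht : 0 < t) : IntegrableOn (besselAuxDeriv w p t) (Ioi 0) := by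
  refine ((integrableOn_exp_neg_mul_sq hp).const_mul
    ((1 / w.re + 4 * ‖w‖ / w.re ^ 2) / t ^ 2)).mono'
    (measurable_besselAuxDeriv w p t).aestronglyMeasurable ?_
  filter_upwards [ae_restrict_mem measurableSet_Ioi] with s hs
  exact norm_besselAuxDeriv_le hw p ht hs

/-- The combination `-besselAuxDeriv - 2p besselKernel` is the `s`-derivative of `s⁻¹ besselKernel`,
which tends to `0` at both ends. This closes the first-order system for `besselIntegral` and
`besselIntegralAux`. -/
lemma integral_besselAuxDeriv {w p : ℂ} (hw : 0 < w.re) (hp : 0 < p.re) {t : ℝ} (ht : 0 < t) :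
    ∫ s in Ioi (0 : ℝ), besselAuxDeriv w p t s = -2 * p * besselIntegral w p t := by
  have hI1 : IntegrableOn (fun s => -besselAuxDeriv w p t s) (Ioi 0) :=
    (integrableOn_besselAuxDeriv hw hp ht).neg
  have hI2 := (integrableOn_besselKernel hw hp t).const_mul (2 * p)
  have hder : ∀ s ∈ Ioi (0 : ℝ), HasDerivAt (fun s : ℝ => (s⁻¹ : ℂ) * besselKernel w p t s)
      (-besselAuxDeriv w p t s - 2 * p * besselKernel w p t s) s := by
    intro s hs
    have hs0 : (s : ℂ) ≠ 0 := by exact_mod_cast (ne_of_gt hs)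
    have hid : HasDerivAt (fun s : ℝ => (s : ℂ)) 1 s := Complex.ofRealCLM.hasDerivAt
    have h1 := hid.inv hs0
    have h2 := ((((((hasDerivAt_const s (t : ℂ)).div hid hs0)).pow 2).const_mul w).neg.sub
      ((hid.pow 2).const_mul p)).cexp
    refine (h1.mul h2).congr_deriv ?_
    simp only [besselAuxDeriv, besselKernel, Pi.div_apply, Pi.pow_apply, Pi.neg_apply,
      Pi.sub_apply, Pi.inv_apply]
    push_cast
    generalize Complex.exp _ = e
    field_simp
    ring
  have hsmall : ∀ s : ℝ, ‖(s⁻¹ : ℂ) * besselKernel w p t s‖ ≤ |s| / (w.re * t ^ 2) := by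
    intro s
    rcases eq_or_ne s 0 with rfl | hs
    · simp
    have h := pow_mul_norm_besselKernel_le hw p t s 1
    rw [pow_one, pow_one, Nat.factorial_one, Nat.cast_one] at h
    have h' : (t / s) ^ 2 * ‖besselKernel w p t s‖ ≤ 1 / w.re := by
      refine h.trans (mul_le_of_le_one_right (by positivity) (Real.exp_le_one_iff.2 ?_))
      nlinarith [sq_nonneg s]
    rw [norm_mul, norm_inv, Complex.norm_real, Real.norm_eq_abs]
    have hs' : 0 < |s| := abs_pos.2 hs
    have e : |s|⁻¹ = |s| / t ^ 2 * (t / s) ^ 2 := by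
      rw [div_pow, ← sq_abs s]; field_simp
    rw [e, mul_assoc]
    refine (mul_le_mul_of_nonneg_left h' (by positivity)).trans (le_of_eq ?_)
    field_simp
  -- The convention `0⁻¹ = 0` gives the function its limiting value at `s = 0`.
  have hcont : ContinuousWithinAt (fun s : ℝ => (s⁻¹ : ℂ) * besselKernel w p t s) (Ici 0) 0 := by
    refine ContinuousAt.continuousWithinAt ?_
    rw [ContinuousAt, Complex.ofReal_zero, inv_zero, zero_mul]
    refine squeeze_zero_norm hsmall ?_
    have : Continuous fun s : ℝ => |s| / (w.re * t ^ 2) := by fun_prop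
    simpa using this.tendsto 0
  have hlim : Tendsto (fun s : ℝ => (s⁻¹ : ℂ) * besselKernel w p t s) atTop (𝓝 0) := by
    refine squeeze_zero_norm' ?_ tendsto_inv_atTop_zero
    filter_upwards [eventually_gt_atTop 0] with s hs
    rw [norm_mul, norm_inv, Complex.norm_real, Real.norm_of_nonneg hs.le]
    refine mul_le_of_le_one_right (by positivity) ((norm_besselKernel_le hw p t s).trans
      (Real.exp_le_one_iff.2 ?_))
    nlinarith [sq_nonneg s]
  have h := integral_Ioi_of_hasDerivAt_of_tendsto hcont hder (hI1.sub hI2) hlim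
  simp only [Complex.ofReal_zero, inv_zero, zero_mul, sub_zero] at h
  rw [integral_sub hI1 hI2] at h
  rw [integral_neg, integral_const_mul] at h
  rw [besselIntegral]
  linear_combination -h

lemma hasDerivAt_besselIntegralAux {w p : ℂ} (hw : 0 < w.re) (hp : 0 < p.re) {t : ℝ}
    (ht : 0 < t) :
    HasDerivAt (besselIntegralAux w p) (-2 * p * besselIntegral w p t) t := by
  have hI := (integrableOn_exp_neg_mul_sq hp).const_mul
    ((1 / w.re + 4 * ‖w‖ / w.re ^ 2) / (t / 2) ^ 2)
  have h := hasDerivAt_integral_of_dominated_loc_of_deriv_le (μ := volume.restrict (Ioi 0))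
    (F := fun (t s : ℝ) => ((t / s ^ 2 : ℝ) : ℂ) * besselKernel w p t s)
    (F' := besselAuxDeriv w p)
    (Ioi_mem_nhds (half_lt_self ht))
    (Eventually.of_forall fun t => Measurable.aestronglyMeasurable (by
      have := measurable_besselKernel w p t
      fun_prop))
    (integrableOn_aux_integrand hw hp ht)
    (measurable_besselAuxDeriv w p t).aestronglyMeasurable
    ?_ hI
    (Eventually.of_forall fun s τ _ => ?_)
  · exact h.2.congr_deriv (integral_besselAuxDeriv hw hp ht)
  · filter_upwards [ae_restrict_mem measurableSet_Ioi] with s hs τ hτ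
    have hτ0 : t / 2 < τ := hτ
    have hτ1 : 0 < τ := by linarith
    refine (norm_besselAuxDeriv_le hw p hτ1 hs).trans ?_
    gcongr
  · have h1 : HasDerivAt (fun t : ℝ => ((t / s ^ 2 : ℝ) : ℂ)) ((1 / s ^ 2 : ℝ) : ℂ) τ :=
      ((hasDerivAt_id τ).div_const (s ^ 2)).ofReal_comp
    refine (h1.mul (hasDerivAt_besselKernel_param w p τ s)).congr_deriv ?_
    rw [besselAuxDeriv]
    push_cast
    ring

lemma continuous_besselIntegral {w p : ℂ} (hw : 0 < w.re) (hp : 0 < p.re) :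
    Continuous (besselIntegral w p) := by
  refine continuous_of_dominated
    (fun t => (measurable_besselKernel w p t).aestronglyMeasurable)
    (fun t => Eventually.of_forall (norm_besselKernel_le hw p t))
    (integrableOn_exp_neg_mul_sq hp) (Eventually.of_forall fun s => ?_)
  unfold besselKernel
  fun_prop

lemma besselIntegral_zero_ne_zero (w : ℂ) {p : ℂ} (hp : 0 < p.re) :
    besselIntegral w p 0 ≠ 0 := by
  have h : besselIntegral w p 0 = (Real.pi / p) ^ (1 / 2 : ℂ) / 2 := by
    rw [← integral_gaussian_complex_Ioi hp, besselIntegral]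
    simp [besselKernel]
  have hp0 : p ≠ 0 := by rintro rfl; simp at hp
  rw [h, Ne, div_eq_zero_iff, Complex.cpow_eq_zero_iff]
  simp [hp0, Real.pi_ne_zero]

lemma eq_const_mul_exp_of_hasDerivAt {f : ℝ → ℂ} {c : ℂ}
    (h : ∀ t : ℝ, 0 < t → HasDerivAt f (c * f t) t) {t : ℝ} (ht : 0 < t) :
    f t = f 1 * Complex.exp (-c) * Complex.exp (c * t) := by
  have hd : ∀ t ∈ Ioi (0 : ℝ), HasDerivAt (fun t : ℝ => f t * Complex.exp (-c * t)) 0 t := by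
    intro t ht
    have h2 : HasDerivAt (fun t : ℝ => Complex.exp (-c * t)) (Complex.exp (-c * t) * (-c * 1)) t :=
      ((Complex.ofRealCLM.hasDerivAt (x := t)).const_mul (-c)).cexp
    refine ((h t ht).mul h2).congr_deriv ?_
    ring
  have hc := isOpen_Ioi.is_const_of_deriv_eq_zero (convex_Ioi (0 : ℝ)).isPreconnected
    (fun t ht => (hd t ht).differentiableAt.differentiableWithinAt)
    (fun t ht => (hd t ht).deriv) (mem_Ioi.2 ht) (mem_Ioi.2 one_pos)
  simp only [Complex.ofReal_one, mul_one] at hc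
  rw [← hc, mul_assoc, ← Complex.exp_add]
  simp

/-- The system `F' = -2a²B`, `B' = -2b²F` has the eigencombination `bF - aB` with growth rate `2ab`.
Boundedness of `F` and `B` away from `0` kills this growing mode, leaving `aB = bF` and so `F' =
-2ab F`. -/
theorem besselIntegral_eq {a b : ℂ} (ha : 0 < (a ^ 2).re) (hb : 0 < (b ^ 2).re)
    (hab : 0 < (a * b).re) {t : ℝ} (ht : 0 < t) :
    besselIntegral (a ^ 2) (b ^ 2) t =
      besselIntegral (a ^ 2) (b ^ 2) 0 * Complex.exp (-(2 * a * b) * t) := by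
  set F := besselIntegral (a ^ 2) (b ^ 2) with hF
  set B := besselIntegralAux (a ^ 2) (b ^ 2) with hB
  have hFd := fun {t : ℝ} (ht : 0 < t) => hasDerivAt_besselIntegral ha hb ht
  have hBd := fun {t : ℝ} (ht : 0 < t) => hasDerivAt_besselIntegralAux ha hb ht
  rw [← hF, ← hB] at hFd hBd
  have hG : ∀ t : ℝ, 0 < t → HasDerivAt (fun t => b * F t - a * B t)
      (2 * a * b * (b * F t - a * B t)) t := fun t ht =>
    (((hFd ht).const_mul b).sub ((hBd ht).const_mul a)).congr_deriv (by ring)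
  have hGexp := fun {t : ℝ} (ht : 0 < t) => eq_const_mul_exp_of_hasDerivAt hG ht
  set J := ∫ s in Ioi (0 : ℝ), Real.exp (-(b ^ 2).re * s ^ 2) with hJ
  have hJ0 : 0 ≤ J := integral_nonneg fun s => (Real.exp_pos _).le
  have hFb : ∀ t, ‖F t‖ ≤ J := fun t =>
    norm_integral_le_of_norm_le (integrableOn_exp_neg_mul_sq hb)
      (Eventually.of_forall (norm_besselKernel_le ha (b ^ 2) t))
  have hBb : ∀ t, 1 ≤ t → ‖B t‖ ≤ 1 / (a ^ 2).re * J := by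
    intro t ht
    have ht0 : 0 < t := by linarith
    refine (norm_integral_le_of_norm_le
      ((integrableOn_exp_neg_mul_sq hb).const_mul (1 / ((a ^ 2).re * t)))
      (Eventually.of_forall (norm_aux_integrand_le ha (b ^ 2) ht0))).trans ?_
    rw [integral_const_mul]
    gcongr
    nlinarith
  have hG1 : b * F 1 - a * B 1 = 0 := by
    by_contra hne
    set k := (b * F 1 - a * B 1) * Complex.exp (-(2 * a * b)) with hk
    have hk0 : 0 < ‖k‖ := norm_pos_iff.2 (mul_ne_zero hne (Complex.exp_ne_zero _))
    have hlim : Tendsto (fun t : ℝ => ‖k‖ * Real.exp (2 * (a * b).re * t)) atTop atTop :=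
      (Real.tendsto_exp_atTop.comp
        (tendsto_id.const_mul_atTop (by positivity))).const_mul_atTop hk0
    obtain ⟨t, ht1, ht⟩ := ((eventually_ge_atTop 1).and
      (hlim.eventually_gt_atTop (‖b‖ * J + ‖a‖ * (1 / (a ^ 2).re * J)))).exists
    have h1 : ‖b * F t - a * B t‖ ≤ ‖b‖ * J + ‖a‖ * (1 / (a ^ 2).re * J) := by
      refine (norm_sub_le _ _).trans ?_
      rw [norm_mul, norm_mul]
      gcongr
      exacts [hFb t, hBb t ht1]
    rw [hGexp (by linarith), norm_mul, Complex.norm_exp, Complex.re_mul_ofReal,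
      mul_assoc, Complex.mul_re] at h1
    simp only [Complex.re_ofNat, Complex.im_ofNat, zero_mul, sub_zero] at h1
    linarith
  have hFB : ∀ t : ℝ, 0 < t → a * B t = b * F t := by
    intro t ht
    have := hGexp ht
    rw [hG1, zero_mul, zero_mul] at this
    exact (sub_eq_zero.1 this).symm
  have hF' : ∀ t : ℝ, 0 < t → HasDerivAt F (-(2 * a * b) * F t) t := fun t ht =>
    (hFd ht).congr_deriv (by linear_combination (-2 * a) * hFB t ht)
  have hFexp := fun {t : ℝ} (ht : 0 < t) => eq_const_mul_exp_of_hasDerivAt hF' ht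
  -- The differential equation is known only for `t > 0`; continuity of `F` carries the constant to
  -- `t = 0`, where `F` is a Gaussian integral.
  have hF0 : F 0 = F 1 * Complex.exp (- -(2 * a * b)) := by
    have h1 : Tendsto F (𝓝[>] 0) (𝓝 (F 0)) :=
      ((continuous_besselIntegral ha hb).tendsto 0).mono_left nhdsWithin_le_nhds
    have h2 : Tendsto (fun t : ℝ => F 1 * Complex.exp (- -(2 * a * b)) *
        Complex.exp (-(2 * a * b) * t)) (𝓝[>] 0) (𝓝 (F 1 * Complex.exp (- -(2 * a * b)) *
        Complex.exp (-(2 * a * b) * (0 : ℝ)))) :=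
      (Continuous.tendsto (by fun_prop) (0 : ℝ)).mono_left nhdsWithin_le_nhds
    rw [Complex.ofReal_zero, mul_zero, Complex.exp_zero, mul_one] at h2
    refine tendsto_nhds_unique h1 (h2.congr' ?_)
    filter_upwards [self_mem_nhdsWithin] with t ht
    exact (hFexp ht).symm
  rw [hF0]
  exact hFexp ht

/-! ### The Laplace transform of `e^{iz/x}` and exactness -/

lemma norm_exp_neg_mul_ofReal (P : ℂ) (x : ℝ) :
    ‖Complex.exp (-P * x)‖ = Real.exp (-P.re * x) := by
  rw [Complex.norm_exp, Complex.re_mul_ofReal, Complex.neg_re]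

lemma continuous_expInvDeriv {z : ℂ} (hz : 0 < z.im) (n : ℕ) : Continuous (expInvDeriv z n) :=
  continuous_iff_continuousAt.2 fun x => (hasDerivAt_expInvDeriv hz n x).continuousAt

lemma integrableOn_expInvDeriv_mul_exp {z P : ℂ} (hz : 0 < z.im) (hP : 0 < P.re) (n : ℕ) :
    IntegrableOn (fun x : ℝ => expInvDeriv z n x * Complex.exp (-P * x)) (Ioi 0) := by
  refine ((exp_neg_integrableOn_Ioi 0 hP).const_mul
    ((((‖z‖ - |z.re|) / 2) ^ n)⁻¹ * (n ! : ℝ) ^ 2)).mono' ?_ (Eventually.of_forall fun x => ?_)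
  · have := continuous_expInvDeriv hz n
    exact Continuous.aestronglyMeasurable (by fun_prop)
  · rw [norm_mul, norm_exp_neg_mul_ofReal]
    gcongr
    exact norm_expInvDeriv_le hz n x

lemma expInvDeriv_zero_right (z : ℂ) (n : ℕ) : expInvDeriv z n 0 = 0 := by simp [expInvDeriv]

lemma mul_integral_expInvDeriv {z P : ℂ} (hz : 0 < z.im) (hP : 0 < P.re) (n : ℕ) :
    P * ∫ x in Ioi (0 : ℝ), expInvDeriv z n x * Complex.exp (-P * x) =
      ∫ x in Ioi (0 : ℝ), expInvDeriv z (n + 1) x * Complex.exp (-P * x) := by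
  have hI1 := integrableOn_expInvDeriv_mul_exp hz hP (n + 1)
  have hI0 := (integrableOn_expInvDeriv_mul_exp hz hP n).const_mul P
  have hder : ∀ x ∈ Ici (0 : ℝ), HasDerivAt
      (fun x : ℝ => expInvDeriv z n x * Complex.exp (-P * x))
      (expInvDeriv z (n + 1) x * Complex.exp (-P * x) -
        P * (expInvDeriv z n x * Complex.exp (-P * x))) x := by
    intro x _
    have h2 : HasDerivAt (fun x : ℝ => Complex.exp (-P * x)) (Complex.exp (-P * x) * (-P * 1)) x :=
      ((Complex.ofRealCLM.hasDerivAt (x := x)).const_mul (-P)).cexp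
    refine ((hasDerivAt_expInvDeriv hz n x).mul h2).congr_deriv ?_
    ring
  have hlim : Tendsto (fun x : ℝ => expInvDeriv z n x * Complex.exp (-P * x)) atTop (𝓝 0) := by
    have hexp : Tendsto (fun x : ℝ => (((‖z‖ - |z.re|) / 2) ^ n)⁻¹ * (n ! : ℝ) ^ 2 *
        Real.exp (-P.re * x)) atTop (𝓝 0) := by
      rw [← mul_zero ((((‖z‖ - |z.re|) / 2) ^ n)⁻¹ * (n ! : ℝ) ^ 2)]
      refine (Real.tendsto_exp_atBot.comp ?_).const_mul _
      exact tendsto_id.const_mul_atTop_of_neg (by linarith)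
    refine squeeze_zero_norm (fun x => ?_) hexp
    rw [norm_mul, norm_exp_neg_mul_ofReal]
    gcongr
    exact norm_expInvDeriv_le hz n x
  have h := integral_Ioi_of_hasDerivAt_of_tendsto' hder (hI1.sub hI0) hlim
  rw [integral_sub hI1 hI0, integral_const_mul, expInvDeriv_zero_right, zero_mul, sub_zero] at h
  exact (sub_eq_zero.1 h).symm

lemma pow_mul_integral_expInvDeriv {z P : ℂ} (hz : 0 < z.im) (hP : 0 < P.re) (n : ℕ) :
    P ^ n * ∫ x in Ioi (0 : ℝ), expInvDeriv z 0 x * Complex.exp (-P * x) =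
      ∫ x in Ioi (0 : ℝ), expInvDeriv z n x * Complex.exp (-P * x) := by
  induction n with
  | zero => simp
  | succ n ih => rw [pow_succ', mul_assoc, ih, mul_integral_expInvDeriv hz hP]

/-- Integration by parts `n` times has no boundary terms, so a bound on the `n`-th derivative
becomes decay of order `|P|^(-n)`. -/
lemma norm_laplace_le {z P : ℂ} (hz : 0 < z.im) (hP : 0 < P.re) (n : ℕ) {M : ℝ}
    (hM : ∀ x : ℝ, 0 ≤ x → ‖expInvDeriv z n x‖ ≤ M) :
    ‖P‖ ^ n * ‖∫ x in Ioi (0 : ℝ), expInvDeriv z 0 x * Complex.exp (-P * x)‖ ≤ M / P.re := by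
  rw [← norm_pow, ← norm_mul, pow_mul_integral_expInvDeriv hz hP]
  refine (norm_integral_le_of_norm_le ((exp_neg_integrableOn_Ioi 0 hP).const_mul M) ?_).trans
    (le_of_eq ?_)
  · filter_upwards [ae_restrict_mem measurableSet_Ioi] with x hx
    rw [norm_mul, norm_exp_neg_mul_ofReal]
    gcongr
    exact hM x (le_of_lt hx)
  · rw [integral_const_mul, integral_exp_mul_Ioi (by linarith)]
    simp
    field_simp

/-- No sign condition is needed: for `x ≤ 0` the integral diverges and both sides take the default
value `0`. -/
lemma integral_exp_neg_sq_mul {x : ℝ} :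
    ∫ r : ℝ, Complex.exp (-(r : ℂ) ^ 2 * x) = (√(Real.pi / x) : ℝ) := by
  rw [← integral_gaussian, ← integral_complex_ofReal]
  congr 1
  ext r
  push_cast
  ring_nf

lemma norm_laplace_integrand (z p : ℂ) (r x : ℝ) :
    ‖expInvDeriv z 0 x * Complex.exp (-(p + (r : ℂ) ^ 2) * x)‖ =
      ‖expInvDeriv z 0 x‖ * Real.exp (-p.re * x) * Real.exp (-x * r ^ 2) := by
  have h : (p + (r : ℂ) ^ 2).re = p.re + r ^ 2 := by
    rw [← Complex.ofReal_pow, Complex.add_re, Complex.ofReal_re]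
  rw [norm_mul, norm_exp_neg_mul_ofReal, h, mul_assoc, ← Real.exp_add]
  ring_nf

lemma integrable_laplace_integrand {z p : ℂ} (hz : 0 < z.im) (hp : 0 < p.re) :
    Integrable (Function.uncurry fun (r x : ℝ) =>
      expInvDeriv z 0 x * Complex.exp (-(p + (r : ℂ) ^ 2) * x))
      (volume.prod (volume.restrict (Ioi 0))) := by
  have hc := continuous_expInvDeriv hz 0
  have hmeas : AEStronglyMeasurable (Function.uncurry fun (r x : ℝ) =>
      expInvDeriv z 0 x * Complex.exp (-(p + (r : ℂ) ^ 2) * x))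
      (volume.prod (volume.restrict (Ioi 0))) :=
    Continuous.aestronglyMeasurable (by unfold Function.uncurry; fun_prop)
  rw [integrable_prod_iff' hmeas]
  have hmeas2 := hmeas.norm.integral_prod_right'
  simp only [Function.uncurry_apply_pair] at hmeas2 ⊢
  constructor
  · filter_upwards [ae_restrict_mem measurableSet_Ioi] with x hx
    refine ((integrable_exp_neg_mul_sq (mem_Ioi.1 hx)).const_mul
      (‖expInvDeriv z 0 x‖ * Real.exp (-p.re * x))).mono'
      (Continuous.aestronglyMeasurable (by fun_prop)) (Eventually.of_forall fun r => ?_)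
    rw [norm_laplace_integrand]
  · simp_rw [norm_laplace_integrand, integral_const_mul, integral_gaussian]
    have hI := (integrableOn_rpow_mul_exp_neg_mul_rpow (p := 1) (s := -(1 / 2)) (b := p.re)
      (by norm_num) one_pos hp).const_mul √Real.pi
    refine hI.mono' (Measurable.aestronglyMeasurable (by have := hc.measurable; fun_prop)) ?_
    filter_upwards [ae_restrict_mem measurableSet_Ioi] with x hx
    have hx0 : 0 < x := hx
    have h1 : ‖expInvDeriv z 0 x‖ ≤ 1 := by simpa using norm_expInvDeriv_le hz 0 x
    rw [Real.norm_of_nonneg (by positivity), Real.rpow_one, Real.rpow_neg hx0.le,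
      ← Real.sqrt_eq_rpow, Real.sqrt_div Real.pi_pos.le]
    calc _ ≤ 1 * Real.exp (-p.re * x) * (√Real.pi / √x) := by gcongr
      _ = _ := by ring

/-- Integrating `e^(-r²x)` over `r` first produces `√(π/x)`; after `x = s²` this cancels the `s` of
the Jacobian, so the remaining integral is elementary. -/
lemma integral_laplace_eq_besselIntegral {z p : ℂ} (hz : 0 < z.im) (hp : 0 < p.re) :
    ∫ r : ℝ, ∫ x in Ioi (0 : ℝ), expInvDeriv z 0 x * Complex.exp (-(p + (r : ℂ) ^ 2) * x) =
      2 * √Real.pi * besselIntegral (-(Complex.I * z)) p 1 := by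
  rw [integral_integral_swap (integrable_laplace_integrand hz hp)]
  have h1 : ∀ x : ℝ, ∫ r : ℝ, expInvDeriv z 0 x * Complex.exp (-(p + (r : ℂ) ^ 2) * x) =
      expInvDeriv z 0 x * Complex.exp (-p * x) * (√(Real.pi / x) : ℝ) := by
    intro x
    rw [← integral_exp_neg_sq_mul, ← integral_const_mul]
    congr 1
    ext r
    rw [mul_assoc, ← Complex.exp_add]
    ring_nf
  simp_rw [h1]
  rw [← integral_comp_rpow_Ioi_of_pos (p := 2) two_pos, besselIntegral, ← integral_const_mul]
  refine setIntegral_congr_fun measurableSet_Ioi fun s hs => ?_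
  have hs0 : 0 < s := hs
  have hsc : (s : ℂ) ≠ 0 := by exact_mod_cast hs0.ne'
  have e1 : (2 : ℝ) - 1 = 1 := by norm_num
  simp only [e1, Real.rpow_one, Real.rpow_two, expInvDeriv, if_pos (pow_pos hs0 2),
    iteratedDeriv_zero, besselKernel]
  rw [Real.sqrt_div Real.pi_pos.le, Real.sqrt_sq hs0.le, ← Complex.exp_add, Complex.real_smul]
  push_cast
  have e2 : Complex.I * z / (s : ℂ) ^ 2 + -p * (s : ℂ) ^ 2 =
      -(-(Complex.I * z) * (1 / s) ^ 2) - p * (s : ℂ) ^ 2 := by ring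
  rw [e2]
  field_simp

lemma besselIntegral_scale (w p : ℂ) {τ : ℝ} (hτ : 0 < τ) :
    besselIntegral w ((τ : ℂ) ^ 2 * p) 1 = (τ⁻¹ : ℝ) * besselIntegral w p τ := by
  have h := integral_comp_mul_left_Ioi (fun s => besselKernel w p τ s) 0 hτ
  rw [mul_zero, Complex.real_smul] at h
  rw [besselIntegral, besselIntegral, ← h]
  congr 1
  ext s
  have : (τ : ℂ) ≠ 0 := by exact_mod_cast hτ.ne'
  simp only [besselKernel]
  push_cast
  rw [div_mul_eq_div_div, div_self this]
  ring_nf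

lemma norm_besselIntegral_le {z p : ℂ} (hz : 0 < z.im) (hp : 0 < p.re) (hp1 : ‖p‖ = 1) (n : ℕ)
    {M : ℝ} (hM : ∀ x : ℝ, 0 ≤ x → ‖expInvDeriv z n x‖ ≤ M) {τ : ℝ} (hτ : 1 ≤ τ) :
    ‖besselIntegral (-(Complex.I * z)) p τ‖ ≤ √Real.pi / (2 * p.re) * τ * (M / (τ ^ 2) ^ n) := by
  have hτ0 : 0 < τ := by linarith
  have hM0 : 0 ≤ M := (norm_nonneg _).trans (hM 0 le_rfl)
  have hre : (((τ : ℂ) ^ 2) * p).re = τ ^ 2 * p.re := by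
    rw [← Complex.ofReal_pow, Complex.re_ofReal_mul]
  have hpre1 : p.re ≤ 1 := (Complex.re_le_norm p).trans hp1.le
  have hpos : 0 < (((τ : ℂ) ^ 2) * p).re := by rw [hre]; positivity
  -- With `P = τ²p + r²`, `Re p > 0` and `|p| = 1`, one has `|P| ≥ τ²`, which supplies the decay in
  -- `τ`. The factor `1/Re P`, with `τ ≥ 1` and `Re p ≤ 1`, supplies integrability in `r`.
  have hbound : ∀ r : ℝ, ‖∫ x in Ioi (0 : ℝ), expInvDeriv z 0 x *
      Complex.exp (-((τ : ℂ) ^ 2 * p + (r : ℂ) ^ 2) * x)‖ ≤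
      M / (τ ^ 2) ^ n / p.re * (1 + r ^ 2)⁻¹ := by
    intro r
    set P : ℂ := (τ : ℂ) ^ 2 * p + (r : ℂ) ^ 2 with hP
    have hPre : P.re = τ ^ 2 * p.re + r ^ 2 := by
      rw [hP, Complex.add_re, hre, ← Complex.ofReal_pow, Complex.ofReal_re]
    have hPim : P.im = τ ^ 2 * p.im := by
      rw [hP, Complex.add_im, ← Complex.ofReal_pow, ← Complex.ofReal_pow, Complex.ofReal_im,
        Complex.im_ofReal_mul, add_zero]
    have hPpos : 0 < P.re := by rw [hPre]; positivity
    have hPn : τ ^ 2 ≤ ‖P‖ := by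
      refine le_of_sq_le_sq ?_ (norm_nonneg _)
      have h1 : ‖p‖ ^ 2 = 1 := by rw [hp1, one_pow]
      rw [Complex.sq_norm, Complex.normSq_apply] at h1 ⊢
      rw [hPre, hPim]
      have h2 : 0 ≤ τ ^ 2 * p.re * r ^ 2 := by positivity
      nlinarith [sq_nonneg (r ^ 2)]
    have h := norm_laplace_le hz hPpos n hM
    have hP0 : 0 < ‖P‖ := (pow_pos hτ0 2).trans_le hPn
    rw [← le_div_iff₀' (by positivity)] at h
    refine h.trans ?_
    have hden : p.re * (1 + r ^ 2) ≤ P.re := by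
      rw [hPre]
      have : 1 ≤ τ ^ 2 := one_le_pow₀ hτ
      nlinarith [sq_nonneg r]
    calc M / P.re / ‖P‖ ^ n ≤ M / (p.re * (1 + r ^ 2)) / (τ ^ 2) ^ n := by gcongr
      _ = _ := by field_simp
  have h := norm_integral_le_of_norm_le
    (integrable_inv_one_add_sq.const_mul (M / (τ ^ 2) ^ n / p.re)) (Eventually.of_forall hbound)
  rw [integral_laplace_eq_besselIntegral hz hpos, besselIntegral_scale _ _ hτ0,
    integral_const_mul, integral_univ_inv_one_add_sq, norm_mul, norm_mul, norm_mul,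
    Complex.norm_real, Complex.norm_real, Complex.norm_ofNat, Real.norm_of_nonneg (by positivity),
    Real.norm_of_nonneg (by positivity)] at h
  have hpi : Real.pi = √Real.pi * √Real.pi := (Real.mul_self_sqrt Real.pi_pos.le).symm
  have hsp : 0 < √Real.pi := Real.sqrt_pos.2 Real.pi_pos
  have h3 : ‖besselIntegral (-(Complex.I * z)) p τ‖ =
      (2 * √Real.pi * (τ⁻¹ * ‖besselIntegral (-(Complex.I * z)) p τ‖)) * (τ / (2 * √Real.pi)) := by
    field_simp
  rw [h3]
  refine (mul_le_mul_of_nonneg_right h (by positivity)).trans (le_of_eq ?_)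
  nth_rewrite 1 [hpi]
  field_simp

/-- A direction `b` near the boundary of the sector in which the decay rate `Re (a b)` is almost
the minimal one. -/
lemma exists_direction {z a : ℂ} (hz : 0 < z.im) (ha : a ^ 2 = -(Complex.I * z)) {σ : ℝ}
    (hσ : (‖z‖ - |z.re|) / 2 < σ) :
    ∃ b : ℂ, ‖b ^ 2‖ = 1 ∧ 0 < (b ^ 2).re ∧ 0 < (a * b).re ∧ (a * b).re ^ 2 < σ := by
  have hlim : Tendsto (fun c : ℝ => z.im * c - |z.re| * √(1 - c ^ 2)) (𝓝[>] 0)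
      (𝓝 (-|z.re|)) := by
    have hc : Continuous fun c : ℝ => z.im * c - |z.re| * √(1 - c ^ 2) := by fun_prop
    have := (hc.tendsto 0).mono_left (nhdsWithin_le_nhds (s := Ioi 0))
    simpa using this
  obtain ⟨c, hc, hc0, hc1⟩ := ((hlim.eventually_lt_const
    (show -|z.re| < 2 * σ - ‖z‖ by linarith)).and (Ioo_mem_nhdsGT one_pos)).exists
  have hc2 : 0 ≤ 1 - c ^ 2 := by nlinarith
  -- The sign of `s` selects the half of the imaginary axis on which `Re (-izq)` tends to `-|Re z|`
  -- rather than `+|Re z|`.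
  obtain ⟨s, hs2, hs⟩ : ∃ s : ℝ, s ^ 2 = 1 - c ^ 2 ∧ z.re * s = -(|z.re| * √(1 - c ^ 2)) := by
    rcases le_total 0 z.re with h | h
    · exact ⟨-√(1 - c ^ 2), by rw [neg_sq, Real.sq_sqrt hc2], by rw [abs_of_nonneg h]; ring⟩
    · exact ⟨√(1 - c ^ 2), by rw [Real.sq_sqrt hc2], by rw [abs_of_nonpos h]; ring⟩
  set q : ℂ := ⟨c, s⟩ with hq
  have hq1 : ‖q‖ = 1 := by
    have : ‖q‖ ^ 2 = 1 := by rw [Complex.sq_norm, Complex.normSq_apply]; simp only [hq]; linarith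
    exact (pow_eq_one_iff_of_nonneg (norm_nonneg q) two_ne_zero).1 this
  obtain ⟨b, hb⟩ := IsAlgClosed.exists_pow_nat_eq q two_pos
  have hab2 : (a * b) ^ 2 = -(Complex.I * z) * q := by rw [mul_pow, ha, hb]
  have hre2 : ((a * b) ^ 2).re = z.im * c + z.re * s := by rw [hab2]; simp [hq]; ring
  have him2 : ((a * b) ^ 2).im = z.im * s - z.re * c := by rw [hab2]; simp [hq]; ring
  have hnorm : ‖(a * b) ^ 2‖ = ‖z‖ := by
    rw [hab2, norm_mul, norm_neg, norm_mul, Complex.norm_I, hq1, one_mul, mul_one]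
  have hre_sq : (a * b).re ^ 2 = (‖(a * b) ^ 2‖ + ((a * b) ^ 2).re) / 2 := by
    rw [norm_pow, Complex.sq_norm, Complex.normSq_apply, sq (a * b), Complex.mul_re (a * b)]
    ring
  have hlt : (a * b).re ^ 2 < σ := by rw [hre_sq, hnorm, hre2, hs]; linarith
  -- Otherwise `(ab)² = -iz q` would lie in `(-∞, 0]`, impossible for a product of two numbers with
  -- positive real part. The sign of `b` is then free to make `Re (ab)` positive.
  have hne : (a * b).re ≠ 0 := by
    intro h0
    have h1 : ((a * b) ^ 2).im = 0 := by rw [sq, Complex.mul_im, h0]; ring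
    have h2 : ((a * b) ^ 2).re ≤ 0 := by
      rw [sq, Complex.mul_re, h0]; nlinarith [mul_self_nonneg (a * b).im]
    rw [him2] at h1
    rw [hre2] at h2
    have h3 : z.im * (z.im * c + z.re * s) = (z.im ^ 2 + z.re ^ 2) * c := by
      linear_combination z.re * h1
    have h4 : 0 < (z.im ^ 2 + z.re ^ 2) * c := by positivity
    nlinarith
  rcases lt_or_gt_of_ne hne with h | h
  · refine ⟨-b, ?_, ?_, ?_, ?_⟩
    · rw [neg_sq, hb, hq1]
    · rw [neg_sq, hb]; exact hc0
    · rw [mul_neg, Complex.neg_re]; linarith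
    · rw [mul_neg, Complex.neg_re, neg_sq]; exact hlt
  · exact ⟨b, by rw [hb, hq1], by rw [hb]; exact hc0, h, hlt⟩

theorem expInv_notMem_gevreyClass {z : ℂ} (hz : 0 < z.im) {σ : ℝ}
    (hσ : (‖z‖ - |z.re|) / 2 < σ) : expInv z ∉ gevreyClass 2 σ (Ici 0) := by
  rintro ⟨-, C, hC⟩
  have hσ0 : 0 < σ := by linarith [norm_sub_abs_re_pos hz]
  obtain ⟨a, ha⟩ := IsAlgClosed.exists_pow_nat_eq (-(Complex.I * z)) two_pos
  obtain ⟨b, hb1, hb, hab, hlt⟩ := exists_direction hz ha hσ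
  have hare : 0 < (a ^ 2).re := by rw [ha]; simpa using hz
  have hC' : ∀ n : ℕ, ∀ x : ℝ, 0 ≤ x →
      ‖expInvDeriv z n x‖ ≤ C * ((σ ^ n)⁻¹ * (n ! : ℝ) ^ 2) := by
    intro n x hx
    have := hC n x hx
    rwa [iteratedDerivWithin_expInv hz n hx, Real.rpow_two, mul_assoc] at this
  have hC0 : 0 ≤ C := by simpa using (norm_nonneg _).trans (hC' 0 0 le_rfl)
  set κ := (a * b).re with hκ
  have hκσ : κ < √σ := Real.lt_sqrt_of_sq_lt hlt
  set F0 := ‖besselIntegral (a ^ 2) (b ^ 2) 0‖ with hF0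
  have hF0pos : 0 < F0 := norm_pos_iff.2 (besselIntegral_zero_ne_zero _ hb)
  set K := √Real.pi / (2 * (b ^ 2).re) * C * (Real.exp 4 * √σ) with hK
  have hK0 : 0 ≤ K := by positivity
  -- The exact value has size `F0 e^(-2κτ)`, while the Gevrey bound optimised at `s = √σ τ` allows
  -- only a multiple of `τ² e^(-2√σ τ)`. As `κ < √σ`, letting `τ → ∞` contradicts `F0 > 0`.
  have hmain : ∀ τ : ℝ, 1 ≤ τ → 1 ≤ √σ * τ → F0 ≤ K * τ ^ 2 * Real.exp (-(2 * (√σ - κ)) * τ) := by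
    intro τ hτ hs
    have hτ0 : 0 < τ := by linarith
    obtain ⟨n, hn⟩ := exists_sq_factorial_div_pow_le hs
    have h1 := norm_besselIntegral_le hz hb hb1 n (hC' n) hτ
    rw [← ha, besselIntegral_eq hare hb hab hτ0, norm_mul, ← hF0, norm_exp_neg_mul_ofReal,
      show (2 * a * b).re = 2 * κ by rw [mul_assoc, hκ]; simp] at h1
    have h2 : C * ((σ ^ n)⁻¹ * (n ! : ℝ) ^ 2) / (τ ^ 2) ^ n =
        C * ((n ! : ℝ) ^ 2 / ((√σ * τ) ^ 2) ^ n) := by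
      rw [mul_pow √σ, Real.sq_sqrt hσ0.le, mul_pow]
      field_simp
    rw [h2] at h1
    have h3 : F0 * Real.exp (-(2 * κ) * τ) ≤ √Real.pi / (2 * (b ^ 2).re) * τ *
        (C * (Real.exp 4 * (√σ * τ) * Real.exp (-2 * (√σ * τ)))) :=
      h1.trans (by gcongr)
    have h4 := mul_le_mul_of_nonneg_right h3 (Real.exp_pos (2 * κ * τ)).le
    rw [mul_assoc F0, ← Real.exp_add, show -(2 * κ) * τ + 2 * κ * τ = 0 by ring, Real.exp_zero,
      mul_one] at h4
    refine h4.trans (le_of_eq ?_)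
    rw [show -(2 * (√σ - κ)) * τ = -2 * (√σ * τ) + 2 * κ * τ by ring, Real.exp_add, hK]
    ring
  have hd : 0 < 2 * (√σ - κ) := by linarith
  have hlim : Tendsto (fun τ : ℝ => K * (τ ^ 2 * Real.exp (-(2 * (√σ - κ)) * τ))) atTop
      (𝓝 (K * 0)) := by
    refine Tendsto.const_mul _ ?_
    have := tendsto_rpow_mul_exp_neg_mul_atTop_nhds_zero 2 _ hd
    simpa using this
  rw [mul_zero] at hlim
  have hσs : 0 < √σ := Real.sqrt_pos.2 hσ0
  obtain ⟨τ, hτ, hτ1, hτ2⟩ := ((hlim.eventually_lt_const hF0pos).and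
    ((eventually_ge_atTop 1).and (eventually_ge_atTop (√σ)⁻¹))).exists
  have := hmain τ hτ1 (by rwa [← inv_le_iff_one_le_mul₀' hσs])
  rw [mul_assoc] at this
  linarith

theorem mainTheorem5 :
    (∀ z : ℂ, 0 < z.im →
      expInv z ∈ exactGevreyClass 2 ((‖z‖ - |z.re|) / 2) (Set.Ici 0)) ∧
    (∀ (σ : ℝ) (u : ℝ → ℂ), 0 < σ → ContDiff ℝ ∞ u → HasCompactSupport u →
      ((∃ C : ℝ, ∀ ξ : ℝ, ‖fourierHat u ξ‖ ≤
          C * japaneseBracket ξ ^ (-(1 / 4) : ℝ) * Real.exp (-2 * |σ * ξ| ^ (1 / 2 : ℝ))) →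
        u ∈ gevreyClass 2 σ Set.univ) ∧
      ((∃ C : ℝ, ∀ ξ : ℝ, ‖fourierHat u ξ‖ ≤ C * Real.exp (-2 * |σ * ξ| ^ (1 / 2 : ℝ))) →
        ∃ C : ℝ, ∀ (n : ℕ) (x : ℝ), ‖iteratedDeriv n u x‖ ≤
          C * ((n : ℝ) + 1) ^ (1 / 2 : ℝ) * (σ ^ n)⁻¹ * ((n ! : ℕ) : ℝ) ^ (2 : ℝ)) ∧
      (u ∈ gevreyClass 2 σ Set.univ →
        ∃ C : ℝ, ∀ ξ : ℝ, ‖fourierHat u ξ‖ ≤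
          C * japaneseBracket ξ ^ (1 / 2 : ℝ) * Real.exp (-2 * |σ * ξ| ^ (1 / 2 : ℝ)))) := by
  refine ⟨fun z hz => ⟨expInv_mem_gevreyClass hz, ?_⟩, fun σ u hσ hu hc => ⟨?_, ?_, ?_⟩⟩
  · simp only [mem_iUnion, not_exists]
    exact fun σ' hσ' => expInv_notMem_gevreyClass hz hσ'
  · rintro ⟨C, hC⟩
    exact mem_gevreyClass_of_fourierHat_le hu hc hσ hC
  · rintro ⟨C, hC⟩
    exact norm_iteratedDeriv_le_sqrt_of_fourierHat_le hu hc hσ hC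
  · exact fourierHat_le_of_mem_gevreyClass hu hc hσ
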